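/- There exist absolute constants $C,c>0$ such that the following holds. Let $\Sigma\in\mathbb{R}^{n\times n}$ be a symmetric positive definite matrix with smallest and largest eigenvalues $\lambda_{\min}(\Sigma)$, $\lambda_{\max}(\Sigma)$ and condition number $\kappa(\Sigma)=\lambda_{\max}(\Sigma)/\lambda_{\min}(\Sigma)$, let $0<s\le n$ be a real number, and let $x\in\mathbb{R}^n$ have at most $s$ non-zero entries and satisfy $\|\Sigma^{1/2}x\|_2=1$. Let $a_1,\dots,a_m$ be independent random vectors in $\mathbb{R}^n$ with distribution $N(0,\Sigma)$, and let $y_1,\dots,y_m$ be $\{-1,1\}$-valued random variables that are conditionally independent given $\{a_1,\dots,a_m\}$ and satisfy $$\mathbb{E}\big[y_i\mid a_1,\dots,a_m\big]=\theta(\langle a_i,x\rangle)\quad\text{a.s.},\qquad i=1,\dots,m,$$ for some measurable function $\theta:\mathbb{R}\to\mathbb{R}$ with $\lambda:=\mathbb{E}\,[\theta(g)g]>0$, where $g\sim N(0,1)$. Let $\delta>0$ and suppose that $$m\ \ge\ C\,\kappa(\Sigma)\,\delta^{-2}\,s\log(2n/s).$$ Then with probability at least $1-8\exp(-c\delta^2m)$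 the convex program $$\max_{x'\in\mathbb{R}^n}\ \sum_{i=1}^m y_i\langle a_i,x'\rangle\quad\text{subject to}\quad \|x'\|_1\le\sqrt{s/\lambda_{\min}(\Sigma)}\ \text{ and }\ \|\Sigma^{1/2}x'\|_2\le 1$$ has a solution, and every solution $\hat x$ satisfies $$\lambda_{\min}(\Sigma)\,\|\hat x-x\|_2^2\ \le\ \|\Sigma^{1/2}\hat x-\Sigma^{1/2}x\|_2^2\ \le\ \delta/\lambda .$$ -/

import Mathlib

open MeasureTheory ProbabilityTheory
open scoped MatrixOrder

noncomputable section

namespace OneBit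

/-- The smallest eigenvalue of a (symmetric) real matrix. -/
def lambdaMin {n : ℕ} (S : Matrix (Fin n) (Fin n) ℝ) : ℝ := sInf (spectrum ℝ S)

/-- The largest eigenvalue of a (symmetric) real matrix. -/
def lambdaMax {n : ℕ} (S : Matrix (Fin n) (Fin n) ℝ) : ℝ := sSup (spectrum ℝ S)

/-- The condition number of a positive definite matrix. -/
def condNumber {n : ℕ} (S : Matrix (Fin n) (Fin n) ℝ) : ℝ := lambdaMax S / lambdaMin S

/-- The map `x ↦ S^{1/2} x` on Euclidean space, where `S^{1/2}` is the positive semidefinite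
square root of the positive semidefinite matrix `S`. -/
def sqrtMap {n : ℕ} (S : Matrix (Fin n) (Fin n) ℝ) :
    EuclideanSpace ℝ (Fin n) →L[ℝ] EuclideanSpace ℝ (Fin n) :=
  Matrix.toEuclideanCLM (𝕜 := ℝ) (CFC.sqrt S)

/-- The `ℓ₁` norm. -/
def l1Norm {n : ℕ} (x : EuclideanSpace ℝ (Fin n)) : ℝ := ∑ i, |x i|

/-- The number of nonzero entries. -/
def l0Norm {n : ℕ} (x : EuclideanSpace ℝ (Fin n)) : ℕ := hammingNorm (fun i => x i)

/-- The correlation coefficient `𝔼 θ(g) g`, with `g` standard normal. -/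
def correlation (θ : ℝ → ℝ) : ℝ := ∫ z, θ z * z ∂(gaussianReal 0 1)

/-- The real random variables `y i` are conditionally independent given the σ-algebra `F`. -/
def CondIndepGiven {Ω : Type*} {m : ℕ} (F : MeasurableSpace Ω) [mΩ : MeasurableSpace Ω]
    (μ : Measure Ω) (y : Fin m → Ω → ℝ) : Prop :=
  ∀ (T : Finset (Fin m)) (B : Fin m → Set ℝ), (∀ i, MeasurableSet (B i)) →
    μ⟦⋂ i ∈ T, y i ⁻¹' B i | F⟧ =ᵐ[μ] ∏ i ∈ T, μ⟦y i ⁻¹' B i | F⟧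

/-- The one-bit measurement model with covariance matrix `S`, signal `x` and nonlinearity `θ`:
the `a i` are independent with law `N(0, S)`; given all the `a i`, the `y i` are independent
`{-1, 1}`-valued random variables with conditional mean `θ ⟨a i, x⟩`; and `𝔼 θ(g) g > 0`. -/
structure IsModel {Ω : Type*} [MeasurableSpace Ω] (μ : Measure Ω) {m n : ℕ}
    (S : Matrix (Fin n) (Fin n) ℝ) (x : EuclideanSpace ℝ (Fin n)) (θ : ℝ → ℝ)
    (a : Fin m → Ω → EuclideanSpace ℝ (Fin n)) (y : Fin m → Ω → ℝ) : Prop where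
  measurable_a : ∀ i, Measurable (a i)
  law_a : ∀ i, HasLaw (a i) (multivariateGaussian 0 S) μ
  indep_a : iIndepFun a μ
  measurable_y : ∀ i, Measurable (y i)
  y_mem : ∀ i ω, y i ω = 1 ∨ y i ω = -1
  condIndep_y : CondIndepGiven (MeasurableSpace.comap (fun ω i => a i ω) inferInstance) μ y
  measurable_theta : Measurable θ
  condMean_y : ∀ i, μ[y i | MeasurableSpace.comap (fun ω i => a i ω) inferInstance]
    =ᵐ[μ] fun ω => θ (inner ℝ (a i ω) x)
  correlation_pos : 0 < correlation θ

/-- The feasible set `‖x'‖₁ ≤ √(s / λ_min(S))`, `‖S^{1/2} x'‖₂ ≤ 1`. -/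
def feasibleSet {n : ℕ} (S : Matrix (Fin n) (Fin n) ℝ) (s : ℝ) :
    Set (EuclideanSpace ℝ (Fin n)) :=
  {x' | l1Norm x' ≤ √(s / lambdaMin S) ∧ ‖sqrtMap S x'‖ ≤ 1}

/-- `xhat` solves the convex program `max ∑ i, y i * ⟨a i, x'⟩` subject to `x' ∈ feasibleSet S s`,
for given measurement vectors `a` and measurements `y`. -/
def IsSolution {m n : ℕ} (S : Matrix (Fin n) (Fin n) ℝ) (s : ℝ)
    (a : Fin m → EuclideanSpace ℝ (Fin n)) (y : Fin m → ℝ)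
    (xhat : EuclideanSpace ℝ (Fin n)) : Prop :=
  xhat ∈ feasibleSet S s ∧
    IsMaxOn (fun x' => ∑ i, y i * inner ℝ (a i) x') (feasibleSet S s) xhat

end OneBit

end

/-!
For a fixed direction `w`, the objective `∑ i, yᵢ ⟨aᵢ, w⟩` has mean `m λ ⟨Σ^{1/2} x, Σ^{1/2} w⟩`, by
conditioning on the `aᵢ` and Gaussian regression. Let `D w` be its deviation from the mean, a random
linear functional. If `x̂` is a solution, then optimality gives
`m λ (1 - ⟨Σ^{1/2} x, Σ^{1/2} x̂⟩) ≤ D (x̂ - x) = D x̂ + D (-x)`, so it is enough that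
`D ≤ δ m / 4` on the feasible set.

Each summand of `D w` is subgaussian, by symmetrisation, so `D w ≤ t m ‖Σ^{1/2} w‖² + ρ / t` fails
with probability at most `exp (-ρ)`. The quadratic term is what makes a union bound possible:
Maurey's empirical method, applied to the functional `D w - t m ‖Σ^{1/2} w‖²`, replaces a feasible
point by an average of `k ≈ κ(Σ) s` vertices of the `ℓ₁` ball at a loss of at most `2 t m`. There
are at most `(2n / s) ^ (4k)` such averages, which is absorbed by `exp (-ρ)` for `ρ ≈ δ² m`, and
`t ≈ δ` balances the two error terms.
-/

namespace OneBit

section Covariance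

variable {n : ℕ} {S : Matrix (Fin n) (Fin n) ℝ}

lemma inner_sqrtMap (hS : S.PosSemidef) (u v : EuclideanSpace ℝ (Fin n)) :
    inner ℝ (sqrtMap S u) (sqrtMap S v) = u.ofLp ⬝ᵥ S.mulVec v.ofLp := by
  have hself : IsSelfAdjoint (sqrtMap S) := (CFC.sqrt_nonneg S).isSelfAdjoint.map _
  have hsq : sqrtMap S * sqrtMap S = Matrix.toEuclideanCLM (𝕜 := ℝ) S := by
    rw [sqrtMap, ← map_mul, CFC.sqrt_mul_sqrt_self _ hS.nonneg]
  calc inner ℝ (sqrtMap S u) (sqrtMap S v) = inner ℝ u ((sqrtMap S * sqrtMap S) v) := by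
        rw [← ContinuousLinearMap.adjoint_inner_right, hself.adjoint_eq]; rfl
    _ = u.ofLp ⬝ᵥ S.mulVec v.ofLp := by
        rw [hsq, EuclideanSpace.inner_eq_star_dotProduct]
        simp [dotProduct_comm]

lemma norm_sqrtMap_sq (hS : S.PosSemidef) (v : EuclideanSpace ℝ (Fin n)) :
    ‖sqrtMap S v‖ ^ 2 = v.ofLp ⬝ᵥ S.mulVec v.ofLp := by
  rw [← real_inner_self_eq_norm_sq, inner_sqrtMap hS]

lemma dotProduct_mulVec_mono {S T : Matrix (Fin n) (Fin n) ℝ} (h : S ≤ T) (v : Fin n → ℝ) :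
    v ⬝ᵥ S.mulVec v ≤ v ⬝ᵥ T.mulVec v := by
  have := (Matrix.le_iff.mp h).dotProduct_mulVec_nonneg v
  rwa [star_trivial, Matrix.sub_mulVec, dotProduct_sub, sub_nonneg] at this

lemma dotProduct_algebraMap_mulVec (c : ℝ) (v : EuclideanSpace ℝ (Fin n)) :
    v.ofLp ⬝ᵥ (algebraMap ℝ (Matrix (Fin n) (Fin n) ℝ) c).mulVec v.ofLp = c * ‖v‖ ^ 2 := by
  rw [Algebra.algebraMap_eq_smul_one, Matrix.smul_mulVec, Matrix.one_mulVec, dotProduct_smul,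
    smul_eq_mul, EuclideanSpace.real_norm_sq_eq]
  simp only [dotProduct, sq]

lemma lambdaMin_mul_norm_sq_le (hS : S.PosSemidef) (v : EuclideanSpace ℝ (Fin n)) :
    lambdaMin S * ‖v‖ ^ 2 ≤ ‖sqrtMap S v‖ ^ 2 := by
  rw [norm_sqrtMap_sq hS, ← dotProduct_algebraMap_mulVec]
  exact dotProduct_mulVec_mono (algebraMap_le_of_le_spectrum (a := S)
    (fun _ hz => csInf_le S.finite_real_spectrum.bddBelow hz) hS.1) _

lemma norm_sqrtMap_sq_le (hS : S.PosSemidef) (v : EuclideanSpace ℝ (Fin n)) :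
    ‖sqrtMap S v‖ ^ 2 ≤ lambdaMax S * ‖v‖ ^ 2 := by
  rw [norm_sqrtMap_sq hS, ← dotProduct_algebraMap_mulVec]
  exact dotProduct_mulVec_mono (le_algebraMap_of_spectrum_le (a := S)
    (fun _ hz => le_csSup S.finite_real_spectrum.bddAbove hz) hS.1) _

lemma spectrum_nonempty [NeZero n] (hS : S.IsHermitian) : (spectrum ℝ S).Nonempty := by
  rw [hS.spectrum_real_eq_range_eigenvalues]
  exact Set.range_nonempty _

lemma lambdaMin_pos [NeZero n] (hS : S.PosDef) : 0 < lambdaMin S := by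
  have hmem : lambdaMin S ∈ spectrum ℝ S :=
    (spectrum_nonempty hS.1).csInf_mem S.finite_real_spectrum
  rw [hS.1.spectrum_real_eq_range_eigenvalues] at hmem
  obtain ⟨i, hi⟩ := hmem
  exact hi ▸ hS.eigenvalues_pos i

lemma lambdaMin_le_lambdaMax [NeZero n] (hS : S.IsHermitian) : lambdaMin S ≤ lambdaMax S :=
  csInf_le_csSup (spectrum_nonempty hS) S.finite_real_spectrum.bddBelow
    S.finite_real_spectrum.bddAbove

lemma lambdaMax_pos [NeZero n] (hS : S.PosDef) : 0 < lambdaMax S :=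
  (lambdaMin_pos hS).trans_le (lambdaMin_le_lambdaMax hS.1)

lemma one_le_condNumber [NeZero n] (hS : S.PosDef) : 1 ≤ condNumber S :=
  (one_le_div (lambdaMin_pos hS)).2 (lambdaMin_le_lambdaMax hS.1)

end Covariance

section FeasibleSet

variable {n : ℕ} {S : Matrix (Fin n) (Fin n) ℝ} {s : ℝ} {x : EuclideanSpace ℝ (Fin n)}

lemma l1Norm_nonneg (x : EuclideanSpace ℝ (Fin n)) : 0 ≤ l1Norm x :=
  Finset.sum_nonneg fun _ _ => abs_nonneg _

lemma norm_le_l1Norm (x : EuclideanSpace ℝ (Fin n)) : ‖x‖ ≤ l1Norm x := by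
  refine le_of_sq_le_sq ?_ (l1Norm_nonneg x)
  rw [EuclideanSpace.real_norm_sq_eq]
  simpa only [sq_abs, l1Norm] using
    Finset.sum_sq_le_sq_sum_of_nonneg (s := Finset.univ) (f := fun i => |x i|)
      fun _ _ => abs_nonneg _

lemma l1Norm_sq_le (x : EuclideanSpace ℝ (Fin n)) : l1Norm x ^ 2 ≤ l0Norm x * ‖x‖ ^ 2 := by
  classical
  have hsupp : l1Norm x = ∑ i with x i ≠ 0, |x i| :=
    (Finset.sum_filter_of_ne fun i _ hi => by simpa using hi).symm
  have hcs := sq_sum_le_card_mul_sum_sq (s := Finset.univ.filter fun i => x i ≠ 0)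
    (f := fun i => |x i|)
  calc l1Norm x ^ 2 ≤ l0Norm x * ∑ i with x i ≠ 0, |x i| ^ 2 := by rw [hsupp]; exact hcs
    _ ≤ l0Norm x * ∑ i, |x i| ^ 2 := by
        gcongr; exact Finset.filter_subset _ _
    _ = l0Norm x * ‖x‖ ^ 2 := by simp only [sq_abs, EuclideanSpace.real_norm_sq_eq]

lemma neg_mem_feasibleSet (hx : x ∈ feasibleSet S s) : -x ∈ feasibleSet S s := by
  simpa [feasibleSet, l1Norm] using hx

lemma mem_feasibleSet_of_l0Norm_le [NeZero n] (hS : S.PosDef) (hxs : (l0Norm x : ℝ) ≤ s)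
    (hx : ‖sqrtMap S x‖ ≤ 1) : x ∈ feasibleSet S s := by
  refine ⟨Real.le_sqrt_of_sq_le ?_, hx⟩
  rw [le_div_iff₀ (lambdaMin_pos hS)]
  calc l1Norm x ^ 2 * lambdaMin S ≤ l0Norm x * ‖x‖ ^ 2 * lambdaMin S := by
        gcongr
        · exact (lambdaMin_pos hS).le
        · exact l1Norm_sq_le x
    _ = l0Norm x * (lambdaMin S * ‖x‖ ^ 2) := by ring
    _ ≤ l0Norm x * 1 := by
        gcongr
        exact (lambdaMin_mul_norm_sq_le hS.posSemidef x).trans (pow_le_one₀ (norm_nonneg _) hx)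
    _ ≤ s := by rwa [mul_one]

lemma one_le_condNumber_mul [NeZero n] (hS : S.PosDef) (hx : ‖sqrtMap S x‖ = 1)
    (hxK : x ∈ feasibleSet S s) : 1 ≤ condNumber S * s := by
  have hnorm : 1 ≤ lambdaMax S * ‖x‖ ^ 2 := by
    simpa only [hx, one_pow] using norm_sqrtMap_sq_le hS.posSemidef x
  have hnorm_le : ‖x‖ ≤ √(s / lambdaMin S) := (norm_le_l1Norm x).trans hxK.1
  have hx0 : 0 < ‖x‖ := (norm_nonneg x).lt_of_ne' fun h => by norm_num [h] at hnorm
  have hsq : ‖x‖ ^ 2 ≤ s / lambdaMin S := (Real.le_sqrt' hx0).1 hnorm_le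
  calc 1 ≤ lambdaMax S * ‖x‖ ^ 2 := hnorm
    _ ≤ lambdaMax S * (s / lambdaMin S) :=
        mul_le_mul_of_nonneg_left hsq (lambdaMax_pos hS).le
    _ = condNumber S * s := by rw [condNumber]; ring

lemma isCompact_feasibleSet (S : Matrix (Fin n) (Fin n) ℝ) (s : ℝ) :
    IsCompact (feasibleSet S s) := by
  have hcont : Continuous (l1Norm (n := n)) := by unfold l1Norm; fun_prop
  refine Metric.isCompact_of_isClosed_isBounded ?_ ?_
  · exact (isClosed_le hcont continuous_const).inter
      (isClosed_le (sqrtMap S).continuous.norm continuous_const)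
  · refine (Metric.isBounded_closedBall (x := (0 : EuclideanSpace ℝ (Fin n)))
      (r := √(s / lambdaMin S))).subset fun v hv => ?_
    exact mem_closedBall_zero_iff.2 ((norm_le_l1Norm v).trans hv.1)

lemma exists_isSolution {m : ℕ} (hne : (feasibleSet S s).Nonempty)
    (a : Fin m → EuclideanSpace ℝ (Fin n)) (y : Fin m → ℝ) : ∃ xhat, IsSolution S s a y xhat := by
  obtain ⟨xhat, hmem, hmax⟩ := (isCompact_feasibleSet S s).exists_isMaxOn hne
    (f := fun x' => ∑ i, y i * inner ℝ (a i) x') (by fun_prop)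
  exact ⟨xhat, hmem, hmax⟩

end FeasibleSet

section SampleSize

variable {n : ℕ} {S : Matrix (Fin n) (Fin n) ℝ} {s : ℝ}

lemma pos_of_one_le_condNumber_mul [NeZero n] (hS : S.PosDef) (hκs : 1 ≤ condNumber S * s) :
    0 < s :=
  pos_of_mul_pos_right (one_pos.trans_le hκs) (zero_le_one.trans (one_le_condNumber hS))

lemma two_le_two_mul_div (hs : 0 < s) (hsn : s ≤ n) : 2 ≤ 2 * n / s := by
  rw [le_div_iff₀ hs]
  linarith

lemma sampleSize_pos [NeZero n] (hS : S.PosDef) (hκs : 1 ≤ condNumber S * s) (hsn : s ≤ n)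
    {C δ : ℝ} (hC : 0 < C) (hδ : 0 < δ) :
    0 < C * condNumber S * (δ ^ 2)⁻¹ * s * Real.log (2 * n / s) := by
  have hκ := one_le_condNumber hS
  have hs := pos_of_one_le_condNumber_mul hS hκs
  have hlog := Real.log_pos (one_lt_two.trans_le (two_le_two_mul_div hs hsn))
  positivity

end SampleSize

section Maurey

variable {α V H : Type*} [AddCommGroup V] [Module ℝ V] [NormedAddCommGroup H]
  [InnerProductSpace ℝ H] {e : α → V} {u : V}

lemma exists_map_le_of_mem_convexHull_range (hu : u ∈ convexHull ℝ (Set.range e))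
    (M : V →ₗ[ℝ] ℝ) : ∃ i, M u ≤ M (e i) := by
  obtain ⟨_, ⟨i, rfl⟩, hi⟩ :=
    (M.convexOn convex_univ).exists_ge_of_mem_convexHull (Set.subset_univ _) hu
  exact ⟨i, hi⟩

lemma exists_sym_sum_sub_smul (hu : u ∈ convexHull ℝ (Set.range e)) (L : V →ₗ[ℝ] ℝ)
    (A : V →ₗ[ℝ] H) {B c : ℝ} (hB : ∀ i, ‖A (e i)‖ ^ 2 ≤ B) (hc : 0 ≤ c) (k : ℕ) :
    ∃ σ : Sym α k, -(c * B * k) ≤ L (((σ : Multiset α).map e).sum - (k : ℝ) • u)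
      - c * ‖A (((σ : Multiset α).map e).sum - (k : ℝ) • u)‖ ^ 2 := by
  induction k with
  | zero => exact ⟨Sym.nil, by simp⟩
  | succ k ih =>
    obtain ⟨σ, hσ⟩ := ih
    set T := ((σ : Multiset α).map e).sum - (k : ℝ) • u with hT
    -- Greedy choice: the gain of the new vertex is linear once `‖A (e i - u)‖²` is bounded by
    -- `B - 2 ⟪A u, A (e i - u)⟫`, so some vertex does at least as well as `u` itself.
    obtain ⟨i, hi⟩ := exists_map_le_of_mem_convexHull_range hu
      (L + (2 * c) • (innerₛₗ ℝ (A u - A T)).comp A)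
    have hgain : 0 ≤ L (e i - u) + 2 * c * inner ℝ (A u) (A (e i - u))
        - 2 * c * inner ℝ (A T) (A (e i - u)) := by
      simp only [LinearMap.add_apply, LinearMap.smul_apply, LinearMap.comp_apply,
        innerₛₗ_apply_apply, smul_eq_mul, inner_sub_left] at hi
      simp only [map_sub, inner_sub_right]
      linarith
    have hnorm : ‖A (e i - u)‖ ^ 2 ≤ B - 2 * inner ℝ (A u) (A (e i - u)) := by
      have hexpand := norm_add_sq_real (A u) (A (e i - u))
      rw [← map_add, add_sub_cancel] at hexpand
      linarith [hB i, sq_nonneg ‖A u‖]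
    have hT' : (((i ::ₛ σ : Sym α (k + 1)) : Multiset α).map e).sum - ((k + 1 : ℕ) : ℝ) • u
        = T + (e i - u) := by
      rw [Sym.coe_cons, Multiset.map_cons, Multiset.sum_cons, hT]
      push_cast
      module
    refine ⟨i ::ₛ σ, ?_⟩
    rw [hT', map_add L, map_add A, norm_add_sq_real]
    push_cast
    linarith [mul_le_mul_of_nonneg_left hnorm hc]

/-- The average of the points `e i` over a multiset of `k` indices: the approximants of Maurey's
empirical method. It is the junk value `0` for `k = 0`. -/
noncomputable def symAverage {k : ℕ} (e : α → V) (σ : Sym α k) : V :=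
  (k : ℝ)⁻¹ • ((σ : Multiset α).map e).sum

lemma exists_symAverage_penalized_le (hu : u ∈ convexHull ℝ (Set.range e)) (L : V →ₗ[ℝ] ℝ)
    (A : V →ₗ[ℝ] H) {B c : ℝ} (hB : ∀ i, ‖A (e i)‖ ^ 2 ≤ B) (hc : 0 ≤ c) {k : ℕ} (hk : k ≠ 0) :
    ∃ σ : Sym α k, L u - c * (‖A u‖ ^ 2 + B / k)
      ≤ L (symAverage e σ) - c * ‖A (symAverage e σ)‖ ^ 2 := by
  have hk0 : (0 : ℝ) < k := by positivity
  obtain ⟨σ, hσ⟩ := exists_sym_sum_sub_smul hu (L - (2 * c) • (innerₛₗ ℝ (A u)).comp A) A hB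
    (c := c / k) (by positivity) k
  set T := ((σ : Multiset α).map e).sum - (k : ℝ) • u with hT
  simp only [LinearMap.sub_apply, LinearMap.smul_apply, LinearMap.comp_apply,
    innerₛₗ_apply_apply, smul_eq_mul] at hσ
  have havg : symAverage e σ = u + (k : ℝ)⁻¹ • T := by
    rw [symAverage, hT, smul_sub, inv_smul_smul₀ hk0.ne', add_sub_cancel]
  refine ⟨σ, ?_⟩
  calc L u - c * (‖A u‖ ^ 2 + B / k)
      = L u - c * ‖A u‖ ^ 2 + (k : ℝ)⁻¹ * -(c / k * B * k) := by field_simp; ring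
    _ ≤ L u - c * ‖A u‖ ^ 2
        + (k : ℝ)⁻¹ * (L T - 2 * c * inner ℝ (A u) (A T) - c / k * ‖A T‖ ^ 2) := by gcongr
    _ = L (symAverage e σ) - c * ‖A (symAverage e σ)‖ ^ 2 := by
        rw [havg, map_add L, map_add A, map_smul, map_smul, norm_add_sq_real, norm_smul,
          inner_smul_right, smul_eq_mul, Real.norm_of_nonneg (by positivity)]
        field_simp
        ring

end Maurey

lemma choose_add_le_pow {N k : ℕ} {y : ℝ} (hy : 2 ≤ y) (hN : N ≤ y * k) :
    ((N + k).choose k : ℝ) ≤ y ^ (4 * k) := by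
  have hsucc : y + 1 ≤ y ^ 2 := by nlinarith
  have hexp : Real.exp 1 ≤ y ^ 2 := by nlinarith [Real.exp_one_lt_d9]
  calc ((N + k).choose k : ℝ) ≤ ((N + k : ℕ) : ℝ) ^ k / k.factorial := Nat.choose_le_pow_div _ _
    _ ≤ (y ^ 2 * k) ^ k / k.factorial := by
        gcongr
        push_cast
        nlinarith [Nat.cast_nonneg (α := ℝ) k]
    _ = (y ^ 2) ^ k * ((k : ℝ) ^ k / k.factorial) := by rw [mul_pow, mul_div_assoc]
    _ ≤ (y ^ 2) ^ k * Real.exp k := by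
        gcongr
        exact Real.pow_div_factorial_le_exp _ k.cast_nonneg k
    _ = (y ^ 2) ^ k * Real.exp 1 ^ k := by rw [← Real.exp_nat_mul, mul_one]
    _ ≤ (y ^ 2) ^ k * (y ^ 2) ^ k := by gcongr
    _ = y ^ (4 * k) := by ring

lemma choose_add_mul_exp_le {N k : ℕ} {z ρ : ℝ} (hz : 2 ≤ z) (hN : N ≤ z * k)
    (hρ : 4 * k * Real.log z ≤ ρ) :
    ((N + k).choose k : ℝ) * Real.exp (-(2 * ρ)) ≤ Real.exp (-ρ) := by
  have hpow : z ^ (4 * k) ≤ Real.exp ρ := by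
    rw [← Real.log_le_iff_le_exp (by positivity), Real.log_pow]
    exact_mod_cast hρ
  calc ((N + k).choose k : ℝ) * Real.exp (-(2 * ρ)) ≤ Real.exp ρ * Real.exp (-(2 * ρ)) := by
        gcongr
        exact (choose_add_le_pow hz hN).trans hpow
    _ = Real.exp (-ρ) := by rw [← Real.exp_add]; ring_nf

section CrossPolytope

variable {n : ℕ} {r : ℝ} {S : Matrix (Fin n) (Fin n) ℝ}

/-- The vertices `± r eⱼ` of the `ℓ₁` ball of radius `r`, together with its centre, which has the
index `none` and makes every point of the ball a convex combination with explicit weights. -/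
noncomputable def crossVertex (r : ℝ) : Option (Fin n × Bool) → EuclideanSpace ℝ (Fin n)
  | none => 0
  | some (j, b) => EuclideanSpace.single j (if b then r else -r)

lemma norm_crossVertex_sq_le (r : ℝ) (i : Option (Fin n × Bool)) :
    ‖crossVertex r i‖ ^ 2 ≤ r ^ 2 := by
  rcases i with _ | ⟨j, _ | _⟩ <;> simp [crossVertex, sq_nonneg]

lemma mem_convexHull_range_crossVertex (hr : 0 < r) {u : EuclideanSpace ℝ (Fin n)}
    (hu : l1Norm u ≤ r) : u ∈ convexHull ℝ (Set.range (crossVertex (n := n) r)) := by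
  let weight : Option (Fin n) → ℝ := fun i => i.elim (1 - l1Norm u / r) fun j => |u j| / r
  let vertex : Option (Fin n) → EuclideanSpace ℝ (Fin n) := fun i =>
    crossVertex r (i.map fun j => (j, decide (0 ≤ u j)))
  refine mem_convexHull_of_exists_fintype weight vertex ?_ ?_ (fun i => ⟨_, rfl⟩) ?_
  · rintro (_ | j)
    · exact sub_nonneg.2 ((div_le_one hr).2 hu)
    · exact div_nonneg (abs_nonneg _) hr.le
  · simp [weight, Fintype.sum_option, l1Norm, Finset.sum_div]
  · have hterm (j : Fin n) :
        (|u j| / r) • vertex (some j) = u j • EuclideanSpace.single j (1 : ℝ) := by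
      rcases le_or_gt 0 (u j) with hj | hj
      · ext i; simp [vertex, crossVertex, hj, abs_of_nonneg, hr.ne']
      · ext i; simp [vertex, crossVertex, hj.not_ge, abs_of_neg hj, hr.ne']
    rw [Fintype.sum_option]
    simp only [weight, Option.elim_some, hterm]
    ext i
    simp [vertex, crossVertex, Pi.single_apply]

lemma card_sym_option_prod_bool (n k : ℕ) :
    Fintype.card (Sym (Option (Fin n × Bool)) k) = (2 * n + k).choose k := by
  rw [Sym.card_sym_eq_choose]
  simp only [Fintype.card_option, Fintype.card_prod, Fintype.card_fin, Fintype.card_bool]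
  congr 1
  omega

lemma norm_sqrtMap_crossVertex_sq_le [NeZero n] (hS : S.PosDef) {s : ℝ} (hs : 0 ≤ s)
    (i : Option (Fin n × Bool)) :
    ‖sqrtMap S (crossVertex √(s / lambdaMin S) i)‖ ^ 2 ≤ condNumber S * s :=
  calc ‖sqrtMap S (crossVertex √(s / lambdaMin S) i)‖ ^ 2
      ≤ lambdaMax S * ‖crossVertex √(s / lambdaMin S) i‖ ^ 2 := norm_sqrtMap_sq_le hS.posSemidef _
    _ ≤ lambdaMax S * √(s / lambdaMin S) ^ 2 :=
        mul_le_mul_of_nonneg_left (norm_crossVertex_sq_le _ i) (lambdaMax_pos hS).le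
    _ = condNumber S * s := by
        rw [Real.sq_sqrt (div_nonneg hs (lambdaMin_pos hS).le), condNumber]
        ring

end CrossPolytope

section Subgaussian

variable {Ω : Type*} [MeasurableSpace Ω] {μ : Measure Ω}

lemma exp_mul_integral_le_mgf [IsProbabilityMeasure μ] {X : Ω → ℝ} {t : ℝ} (hX : Integrable X μ)
    (hexp : Integrable (fun ω => Real.exp (t * X ω)) μ) : Real.exp (t * μ[X]) ≤ mgf X μ t := by
  rw [← integral_const_mul]
  exact convexOn_exp.map_integral_le Real.continuous_exp.continuousOn isClosed_univ
    (ae_of_all _ fun _ => Set.mem_univ _) (hX.const_mul t) hexp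

lemma hasSubgaussianMGF_sub_integral [IsProbabilityMeasure μ] {X : Ω → ℝ} {v : NNReal}
    (hexp : ∀ t : ℝ, Integrable (fun ω => Real.exp (t * X ω)) μ)
    (hsymm : ∀ t : ℝ, mgf X μ t + mgf X μ (-t) ≤ 2 * Real.exp (v * t ^ 2 / 2)) :
    HasSubgaussianMGF (fun ω => X ω - μ[X]) (2 * v) μ := by
  have hX : Integrable X μ := by
    simpa only [pow_one] using
      integrable_pow_of_integrable_exp_mul one_ne_zero (hexp 1) (hexp (-1)) 1
  have hfactor (t z : ℝ) : Real.exp (t * (z - μ[X])) = Real.exp (t * z) * Real.exp (-t * μ[X]) := by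
    rw [← Real.exp_add]; ring_nf
  constructor
  · intro t
    simp only [hfactor]
    exact (hexp t).mul_const _
  · intro t
    calc mgf (fun ω => X ω - μ[X]) μ t
        = mgf X μ t * Real.exp (-t * μ[X]) := by
          simp only [mgf, hfactor, integral_mul_const]
      _ ≤ mgf X μ t * mgf X μ (-t) := by
          gcongr
          · exact mgf_nonneg
          · exact exp_mul_integral_le_mgf hX (hexp (-t))
      _ ≤ Real.exp (v * t ^ 2 / 2) ^ 2 := by
          nlinarith [hsymm t, sq_nonneg (mgf X μ t - mgf X μ (-t)),
            mgf_nonneg (X := X) (μ := μ) (t := t), mgf_nonneg (X := X) (μ := μ) (t := -t)]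
      _ = Real.exp ((2 * v : NNReal) * t ^ 2 / 2) := by
          rw [← Real.exp_nat_mul]
          push_cast
          ring_nf

lemma exp_add_exp_neg_mul_le {ε z : ℝ} (hε : |ε| ≤ 1) :
    Real.exp (ε * z) + Real.exp (-(ε * z)) ≤ Real.exp z + Real.exp (-z) := by
  have hcosh : Real.cosh (ε * z) ≤ Real.cosh z := Real.cosh_le_cosh.2 (by
    rw [abs_mul]
    exact mul_le_of_le_one_left (abs_nonneg z) hε)
  rw [Real.cosh_eq, Real.cosh_eq] at hcosh
  linarith

/- Symmetrisation: only the even part of the moment generating function of `ε * G` is controlled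
by that of `G`, since `ε` may depend on `G`. -/
lemma hasSubgaussianMGF_mul_sub_integral [IsProbabilityMeasure μ] {ε G : Ω → ℝ} {v : NNReal}
    (hG : HasSubgaussianMGF G v μ) (hε : AEStronglyMeasurable ε μ) (hε1 : ∀ᵐ ω ∂μ, |ε ω| ≤ 1) :
    HasSubgaussianMGF (fun ω => ε ω * G ω - ∫ ω', ε ω' * G ω' ∂μ) (2 * v) μ := by
  have hle (t : ℝ) : ∀ᵐ ω ∂μ, Real.exp (t * (ε ω * G ω)) + Real.exp (-t * (ε ω * G ω))
      ≤ Real.exp (t * G ω) + Real.exp (-t * G ω) := by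
    filter_upwards [hε1] with ω hω
    convert exp_add_exp_neg_mul_le (z := t * G ω) hω using 3 <;> ring
  have hint (t : ℝ) := (hG.integrable_exp_mul t).add (hG.integrable_exp_mul (-t))
  have hmeas : AEStronglyMeasurable (fun ω => ε ω * G ω) μ := hε.mul hG.aestronglyMeasurable
  have hexp (t : ℝ) : Integrable (fun ω => Real.exp (t * (ε ω * G ω))) μ := by
    refine (hint t).mono' (Real.continuous_exp.comp_aestronglyMeasurable (hmeas.const_mul t)) ?_
    filter_upwards [hle t] with ω hω
    rw [Real.norm_of_nonneg (Real.exp_pos _).le]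
    exact (le_add_of_nonneg_right (Real.exp_pos _).le).trans hω
  refine hasSubgaussianMGF_sub_integral hexp fun t => ?_
  calc mgf (fun ω => ε ω * G ω) μ t + mgf (fun ω => ε ω * G ω) μ (-t)
      = ∫ ω, (Real.exp (t * (ε ω * G ω)) + Real.exp (-t * (ε ω * G ω))) ∂μ :=
        (integral_add (hexp t) (hexp (-t))).symm
    _ ≤ ∫ ω, (Real.exp (t * G ω) + Real.exp (-t * G ω)) ∂μ :=
        integral_mono_ae ((hexp t).add (hexp (-t))) (hint t) (hle t)
    _ = mgf G μ t + mgf G μ (-t) :=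
        integral_add (hG.integrable_exp_mul t) (hG.integrable_exp_mul (-t))
    _ ≤ 2 * Real.exp (v * t ^ 2 / 2) := by
        have hneg := hG.mgf_le (-t)
        rw [neg_sq] at hneg
        linarith [hG.mgf_le t]

lemma measureReal_tilt_ge_le [IsFiniteMeasure μ] {X : Ω → ℝ} {v : NNReal}
    (hX : HasSubgaussianMGF X v μ) {t : ℝ} (ht : 0 < t) (r : ℝ) :
    μ.real {ω | v * t / 2 + r / t ≤ X ω} ≤ Real.exp (-r) := by
  calc μ.real {ω | v * t / 2 + r / t ≤ X ω}
      ≤ Real.exp (-t * (v * t / 2 + r / t)) * mgf X μ t :=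
        measure_ge_le_exp_mul_mgf _ ht.le (hX.integrable_exp_mul t)
    _ ≤ Real.exp (-t * (v * t / 2 + r / t)) * Real.exp (v * t ^ 2 / 2) := by
        gcongr
        exact hX.mgf_le t
    _ = Real.exp (-r) := by
        rw [← Real.exp_add]
        congr 1
        field_simp
        ring

end Subgaussian

section Independence

variable {Ω ι : Type*} {𝓧 𝓨 : ι → Type*} [mΩ : MeasurableSpace Ω] {μ : Measure Ω}
  [∀ i, MeasurableSpace (𝓧 i)] [∀ i, MeasurableSpace (𝓨 i)] {a : ∀ i, Ω → 𝓧 i}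
  {y : ∀ i, Ω → 𝓨 i}

lemma integral_finset_prod_comp (ha : ∀ i, Measurable (a i)) (hindep : iIndepFun a μ)
    {g : ∀ i, 𝓧 i → ℝ} (hg : ∀ i, Measurable (g i)) (T : Finset ι) :
    ∫ ω, ∏ i ∈ T, g i (a i ω) ∂μ = ∏ i ∈ T, ∫ ω, g i (a i ω) ∂μ := by
  have hT : iIndepFun (fun i : T => a i) μ := hindep.precomp Subtype.val_injective
  have hsub := hT.integral_fun_prod_comp (f := fun i : T => g i)
    (fun i => (ha i).aemeasurable) fun i => (hg i).aestronglyMeasurable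
  simpa only [Finset.prod_coe_sort T fun i => ∫ ω, g i (a i ω) ∂μ,
    fun ω => Finset.prod_coe_sort T fun i => g i (a i ω)] using hsub

lemma measureReal_biInter_inter_of_condExp [IsFiniteMeasure μ] (ha : ∀ i, Measurable (a i))
    (hindep : iIndepFun a μ) (hy : ∀ i, Measurable (y i)) {A : ∀ i, Set (𝓧 i)}
    (hA : ∀ i, MeasurableSet (A i)) {B : ∀ i, Set (𝓨 i)} (hB : ∀ i, MeasurableSet (B i))
    {f : ∀ i, 𝓧 i → ℝ} (hf : ∀ i, Measurable (f i)) {T : Finset ι}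
    (hcond : μ⟦⋂ i ∈ T, y i ⁻¹' B i | MeasurableSpace.comap (fun ω i => a i ω) inferInstance⟧
      =ᵐ[μ] fun ω => ∏ i ∈ T, f i (a i ω)) :
    μ.real (⋂ i ∈ T, (a i ⁻¹' A i ∩ y i ⁻¹' B i))
      = ∏ i ∈ T, ∫ ω, (A i).indicator (f i) (a i ω) ∂μ := by
  have hle : MeasurableSpace.comap (fun ω i => a i ω) inferInstance ≤ mΩ :=
    (measurable_pi_lambda _ ha).comap_le
  have hsplit : (⋂ i ∈ T, (a i ⁻¹' A i ∩ y i ⁻¹' B i))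
      = (⋂ i ∈ T, a i ⁻¹' A i) ∩ (⋂ i ∈ T, y i ⁻¹' B i) := by
    simp only [Set.iInter_inter_distrib]
  have hmA : MeasurableSet[MeasurableSpace.comap (fun ω i => a i ω) inferInstance]
      (⋂ i ∈ T, a i ⁻¹' A i) :=
    Finset.measurableSet_biInter _ fun i _ =>
      ⟨(fun v => v i) ⁻¹' A i, measurable_pi_apply i (hA i), rfl⟩
  have hmY : MeasurableSet (⋂ i ∈ T, y i ⁻¹' B i) :=
    Finset.measurableSet_biInter _ fun i _ => hy i (hB i)
  calc μ.real (⋂ i ∈ T, (a i ⁻¹' A i ∩ y i ⁻¹' B i))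
      = ∫ ω in ⋂ i ∈ T, a i ⁻¹' A i, (⋂ i ∈ T, y i ⁻¹' B i).indicator (fun _ => (1 : ℝ)) ω ∂μ := by
        rw [hsplit, setIntegral_indicator hmY, setIntegral_const, smul_eq_mul, mul_one]
    _ = ∫ ω in ⋂ i ∈ T, a i ⁻¹' A i, ∏ i ∈ T, f i (a i ω) ∂μ := by
        rw [← setIntegral_condExp hle ((integrable_const (1 : ℝ)).indicator hmY) hmA]
        exact setIntegral_congr_ae (hle _ hmA) (hcond.mono fun _ hω _ => hω)
    _ = ∫ ω, ∏ i ∈ T, (A i).indicator (f i) (a i ω) ∂μ := by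
        rw [← integral_indicator (hle _ hmA)]
        refine integral_congr_ae (ae_of_all _ fun ω => ?_)
        rw [← Finset.prod_fn]
        exact (prod_indicator_apply T (fun i => a i ⁻¹' A i) (fun i ω => f i (a i ω)) ω).symm
    _ = ∏ i ∈ T, ∫ ω, (A i).indicator (f i) (a i ω) ∂μ :=
        integral_finset_prod_comp ha hindep (fun i => (hf i).indicator (hA i)) T

lemma iIndepFun_prodMk_of_measure_biInter [IsProbabilityMeasure μ] (ha : ∀ i, Measurable (a i))
    (hy : ∀ i, Measurable (y i))
    (hprod : ∀ (T : Finset ι) (A : ∀ i, Set (𝓧 i)) (B : ∀ i, Set (𝓨 i)),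
      (∀ i, MeasurableSet (A i)) → (∀ i, MeasurableSet (B i)) →
      μ (⋂ i ∈ T, (a i ⁻¹' A i ∩ y i ⁻¹' B i)) = ∏ i ∈ T, μ (a i ⁻¹' A i ∩ y i ⁻¹' B i)) :
    iIndepFun (fun i ω => (a i ω, y i ω)) μ := by
  rw [iIndepFun_iff_iIndep]
  refine iIndepSets.iIndep (fun i => ((ha i).prodMk (hy i)).comap_le)
    (fun i => (fun s => (fun ω => (a i ω, y i ω)) ⁻¹' s) ''
      Set.image2 (· ×ˢ ·) {A | MeasurableSet A} {B | MeasurableSet B})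
    (fun i => isPiSystem_prod.comap _)
    (fun i => by rw [← generateFrom_prod, MeasurableSpace.comap_generateFrom]) ?_
  rw [iIndepSets_iff]
  intro T f hf
  have hrect (i : ι) : ∃ A : Set (𝓧 i), ∃ B : Set (𝓨 i), MeasurableSet A ∧
      MeasurableSet B ∧ (i ∈ T → f i = a i ⁻¹' A ∩ y i ⁻¹' B) := by
    by_cases hi : i ∈ T
    · obtain ⟨_, ⟨A, hA, B, hB, rfl⟩, hfi⟩ := hf i hi
      exact ⟨A, B, hA, hB, fun _ => hfi.symm⟩
    · exact ⟨∅, ∅, .empty, .empty, fun h => absurd h hi⟩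
  choose A B hA hB hAB using hrect
  rw [Set.iInter₂_congr hAB, Finset.prod_congr rfl fun i hi => congrArg μ (hAB i hi)]
  exact hprod T A B hA hB

lemma iIndepFun_prodMk_of_condExp [IsProbabilityMeasure μ] (ha : ∀ i, Measurable (a i))
    (hindep : iIndepFun a μ) (hy : ∀ i, Measurable (y i)) {q : ∀ i, Set (𝓨 i) → 𝓧 i → ℝ}
    (hq : ∀ i B, MeasurableSet B → Measurable (q i B))
    (hcond : ∀ (T : Finset ι) (B : ∀ i, Set (𝓨 i)), (∀ i, MeasurableSet (B i)) →
      μ⟦⋂ i ∈ T, y i ⁻¹' B i | MeasurableSpace.comap (fun ω i => a i ω) inferInstance⟧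
        =ᵐ[μ] fun ω => ∏ i ∈ T, q i (B i) (a i ω)) :
    iIndepFun (fun i ω => (a i ω, y i ω)) μ := by
  refine iIndepFun_prodMk_of_measure_biInter ha hy fun T A B hA hB => ?_
  have hinter (T : Finset ι) := measureReal_biInter_inter_of_condExp ha hindep hy hA hB
    (fun i => hq i (B i) (hB i)) (hcond T B hB)
  have hsingle (i : ι) : μ.real (a i ⁻¹' A i ∩ y i ⁻¹' B i)
      = ∫ ω, (A i).indicator (q i (B i)) (a i ω) ∂μ := by
    simpa only [Finset.mem_singleton, Set.iInter_iInter_eq_left, Finset.prod_singleton]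
      using hinter {i}
  rw [← ENNReal.toReal_eq_toReal_iff' (measure_ne_top _ _)
    (ENNReal.prod_ne_top fun i _ => measure_ne_top _ _), ENNReal.toReal_prod]
  simpa only [← hsingle, measureReal_def] using hinter T

end Independence

section ConditionalSign

variable {Ω : Type*} {m mΩ : MeasurableSpace Ω} {μ : Measure Ω}

/-- The probability that a `{-1, 1}`-valued random variable with mean `η` lies in `B`. -/
noncomputable def signProb (B : Set ℝ) (η : ℝ) : ℝ :=
  (1 + η) / 2 * B.indicator 1 1 + (1 - η) / 2 * B.indicator 1 (-1)

lemma measurable_signProb (B : Set ℝ) : Measurable (signProb B) := by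
  unfold signProb
  fun_prop

lemma condExp_preimage_of_sign [IsFiniteMeasure μ] (hm : m ≤ mΩ) {Y η : Ω → ℝ}
    (hY : Integrable Y μ) (hsign : ∀ ω, Y ω = 1 ∨ Y ω = -1) (hη : μ[Y | m] =ᵐ[μ] η) (B : Set ℝ) :
    μ⟦Y ⁻¹' B | m⟧ =ᵐ[μ] fun ω => signProb B (η ω) := by
  set b : ℝ := (B.indicator 1 1 + B.indicator 1 (-1)) / 2 with hb
  set d : ℝ := (B.indicator 1 1 - B.indicator 1 (-1)) / 2 with hd
  have haffine : (Y ⁻¹' B).indicator (fun _ => (1 : ℝ)) = (fun _ => b) + d • Y := by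
    ext ω
    change B.indicator 1 (Y ω) = b + d * Y ω
    rcases hsign ω with h | h <;> rw [h, hb, hd] <;> ring
  rw [haffine]
  filter_upwards [condExp_add (integrable_const b) (hY.smul d) m, condExp_smul d Y m (μ := μ), hη]
    with ω hadd hsmul hηω
  rw [hadd, Pi.add_apply, hsmul, condExp_const hm, Pi.smul_apply, hηω, smul_eq_mul, signProb]
  ring

lemma integral_mul_eq_integral_condExp_mul [IsFiniteMeasure μ] (hm : m ≤ mΩ) {Y Z : Ω → ℝ}
    (hY : Integrable Y μ) (hZ : StronglyMeasurable[m] Z) (hYZ : Integrable (Y * Z) μ) :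
    ∫ ω, Y ω * Z ω ∂μ = ∫ ω, (μ[Y | m]) ω * Z ω ∂μ :=
  calc ∫ ω, Y ω * Z ω ∂μ = ∫ ω, (μ[Y * Z | m]) ω ∂μ := (integral_condExp hm).symm
    _ = ∫ ω, (μ[Y | m]) ω * Z ω ∂μ :=
        integral_congr_ae (condExp_mul_of_stronglyMeasurable_right hZ hYZ hY)

end ConditionalSign

section GaussianRegression

variable {Ω : Type*} [MeasurableSpace Ω] {μ : Measure Ω} {X Y : Ω → ℝ}

lemma variance_mul_integral_comp_mul [IsProbabilityMeasure μ]
    (hXY : HasGaussianLaw (fun ω => (X ω, Y ω)) μ) (hX0 : μ[X] = 0) (hY0 : μ[Y] = 0)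
    {f : ℝ → ℝ} (hf : Measurable f) (hfX : Integrable (fun ω => f (X ω) * X ω) μ)
    (hfY : Integrable (fun ω => f (X ω) * Y ω) μ) :
    Var[X; μ] * ∫ ω, f (X ω) * Y ω ∂μ = cov[X, Y; μ] * ∫ ω, f (X ω) * X ω ∂μ := by
  have hX : HasGaussianLaw X μ := hXY.fst
  have hY : HasGaussianLaw Y μ := hXY.snd
  have hXm := hX.aemeasurable
  set R : Ω → ℝ := fun ω => Var[X; μ] * Y ω - cov[X, Y; μ] * X ω with hR
  have hXR : HasGaussianLaw (fun ω => (X ω, R ω)) μ :=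
    hXY.map_fun ((ContinuousLinearMap.fst ℝ ℝ ℝ).prod
      (Var[X; μ] • ContinuousLinearMap.snd ℝ ℝ ℝ - cov[X, Y; μ] • ContinuousLinearMap.fst ℝ ℝ ℝ))
  have hcov : cov[X, R; μ] = 0 := by
    rw [hR, covariance_fun_sub_right hX.memLp_two (hY.memLp_two.const_mul _)
      (hX.memLp_two.const_mul _), covariance_const_mul_right, covariance_const_mul_right,
      covariance_self hXm]
    ring
  have hR0 : μ[R] = 0 := by
    rw [hR, integral_sub (hY.integrable.const_mul _) (hX.integrable.const_mul _),
      integral_const_mul, integral_const_mul, hX0, hY0]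
    ring
  have hfR : ∫ ω, f (X ω) * R ω ∂μ = 0 := by
    have hprod := ((hXR.indepFun_of_covariance_eq_zero hcov).comp hf
      measurable_id).integral_fun_mul_eq_mul_integral
      (hf.comp_aemeasurable hXm).aestronglyMeasurable
      (measurable_id.comp_aemeasurable hXR.snd.aemeasurable).aestronglyMeasurable
    simpa only [Function.comp_apply, id_eq, hR0, mul_zero] using hprod
  rw [← sub_eq_zero, ← integral_const_mul, ← integral_const_mul,
    ← integral_sub (hfY.const_mul _) (hfX.const_mul _), ← hfR]
  exact integral_congr_ae (ae_of_all _ fun ω => by simp only [hR]; ring)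

end GaussianRegression

section GaussianVector

variable {Ω : Type*} [MeasurableSpace Ω] {μ : Measure Ω} {n : ℕ} {S : Matrix (Fin n) (Fin n) ℝ}
  {X : Ω → EuclideanSpace ℝ (Fin n)}

lemma hasGaussianLaw_inner_prodMk (hX : HasGaussianLaw X μ) (v w : EuclideanSpace ℝ (Fin n)) :
    HasGaussianLaw (fun ω => (inner ℝ (X ω) v, inner ℝ (X ω) w)) μ := by
  simp_rw [real_inner_comm v, real_inner_comm w]
  exact hX.map_fun ((innerSL ℝ v).prod (innerSL ℝ w))

lemma hasGaussianLaw_inner (hX : HasGaussianLaw X μ) (w : EuclideanSpace ℝ (Fin n)) :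
    HasGaussianLaw (fun ω => inner ℝ (X ω) w) μ :=
  (hasGaussianLaw_inner_prodMk hX w w).fst

lemma integral_inner_eq_zero (hX : HasLaw X (multivariateGaussian 0 S) μ)
    (w : EuclideanSpace ℝ (Fin n)) : ∫ ω, inner ℝ (X ω) w ∂μ = 0 := by
  simp_rw [real_inner_comm w]
  rw [integral_inner hX.hasGaussianLaw.integrable, hX.integral_eq,
    integral_id_multivariateGaussian, inner_zero_right]

lemma covariance_inner (hX : HasLaw X (multivariateGaussian 0 S) μ) (hS : S.PosSemidef)
    (v w : EuclideanSpace ℝ (Fin n)) :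
    cov[fun ω => inner ℝ (X ω) v, fun ω => inner ℝ (X ω) w; μ]
      = inner ℝ (sqrtMap S v) (sqrtMap S w) := by
  rw [inner_sqrtMap hS, ← covarianceBilin_multivariateGaussian (μ := 0) hS,
    covarianceBilin_apply_eq_cov IsGaussian.memLp_two_id,
    ← hX.covariance_fun_comp (by fun_prop) (by fun_prop)]
  simp_rw [real_inner_comm v, real_inner_comm w]

lemma variance_inner (hX : HasLaw X (multivariateGaussian 0 S) μ) (hS : S.PosSemidef)
    (w : EuclideanSpace ℝ (Fin n)) :
    Var[fun ω => inner ℝ (X ω) w; μ] = ‖sqrtMap S w‖ ^ 2 := by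
  rw [← covariance_self (hasGaussianLaw_inner hX.hasGaussianLaw w).aemeasurable,
    covariance_inner hX hS, real_inner_self_eq_norm_sq]

lemma map_inner_eq_gaussianReal (hX : HasLaw X (multivariateGaussian 0 S) μ) (hS : S.PosSemidef)
    (w : EuclideanSpace ℝ (Fin n)) :
    μ.map (fun ω => inner ℝ (X ω) w) = gaussianReal 0 (‖sqrtMap S w‖₊ ^ 2) := by
  rw [(hasGaussianLaw_inner hX.hasGaussianLaw w).map_eq_gaussianReal,
    integral_inner_eq_zero hX, variance_inner hX hS, Real.toNNReal_pow (norm_nonneg _),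
    norm_toNNReal]

lemma hasSubgaussianMGF_inner (hX : HasLaw X (multivariateGaussian 0 S) μ) (hS : S.PosSemidef)
    (w : EuclideanSpace ℝ (Fin n)) :
    HasSubgaussianMGF (fun ω => inner ℝ (X ω) w) (‖sqrtMap S w‖₊ ^ 2) μ where
  integrable_exp_mul t := by
    have hexp := integrable_exp_mul_gaussianReal (μ := 0) (v := ‖sqrtMap S w‖₊ ^ 2) t
    rw [← map_inner_eq_gaussianReal hX hS w] at hexp
    exact hexp.comp_aemeasurable (hasGaussianLaw_inner hX.hasGaussianLaw w).aemeasurable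
  mgf_le t := by
    rw [mgf_gaussianReal (map_inner_eq_gaussianReal hX hS w), zero_mul, zero_add]

lemma integral_comp_inner_mul_inner [IsProbabilityMeasure μ]
    (hX : HasLaw X (multivariateGaussian 0 S) μ) (hS : S.PosSemidef)
    {x : EuclideanSpace ℝ (Fin n)} (hx : ‖sqrtMap S x‖ = 1) {f : ℝ → ℝ} (hf : Measurable f)
    (hint : ∀ v, Integrable (fun ω => f (inner ℝ (X ω) x) * inner ℝ (X ω) v) μ)
    (w : EuclideanSpace ℝ (Fin n)) :
    ∫ ω, f (inner ℝ (X ω) x) * inner ℝ (X ω) w ∂μ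
      = correlation f * inner ℝ (sqrtMap S x) (sqrtMap S w) := by
  have hregression := variance_mul_integral_comp_mul
    (hasGaussianLaw_inner_prodMk hX.hasGaussianLaw x w) (integral_inner_eq_zero hX x)
    (integral_inner_eq_zero hX w) hf (hint x) (hint w)
  have hcorr : ∫ ω, f (inner ℝ (X ω) x) * inner ℝ (X ω) x ∂μ = correlation f := by
    have hg := map_inner_eq_gaussianReal hX hS x
    rw [show ‖sqrtMap S x‖₊ = 1 from NNReal.eq hx, one_pow] at hg
    rw [correlation, ← hg]
    exact (integral_map (hasGaussianLaw_inner hX.hasGaussianLaw x).aemeasurable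
      (hf.mul measurable_id).aestronglyMeasurable).symm
  rw [variance_inner hX hS, hx, one_pow, one_mul, covariance_inner hX hS, hcorr] at hregression
  rw [hregression, mul_comm]

end GaussianVector

section UniformBound

variable {Ω : Type*} [MeasurableSpace Ω] {μ : Measure Ω} [IsProbabilityMeasure μ]

lemma exists_event_forall_lt {α : Type*} [Fintype α] {Y : α → Ω → ℝ}
    (hY : ∀ i, Measurable (Y i)) {b : α → ℝ} {p : ℝ}
    (hp : ∀ i, μ.real {ω | b i ≤ Y i ω} ≤ p) :
    ∃ E, MeasurableSet E ∧ 1 - Fintype.card α * p ≤ μ.real E ∧ ∀ ω ∈ E, ∀ i, Y i ω < b i := by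
  have hmeas : MeasurableSet (⋃ i, {ω | b i ≤ Y i ω}) :=
    MeasurableSet.iUnion fun i => measurableSet_le measurable_const (hY i)
  refine ⟨(⋃ i, {ω | b i ≤ Y i ω})ᶜ, hmeas.compl, ?_, fun ω hω i => ?_⟩
  · rw [probReal_compl_eq_one_sub hmeas]
    gcongr
    calc μ.real (⋃ i, {ω | b i ≤ Y i ω}) ≤ ∑ i, μ.real {ω | b i ≤ Y i ω} :=
          measureReal_iUnion_fintype_le _
      _ ≤ ∑ _i : α, p := Finset.sum_le_sum fun i _ => hp i
      _ = Fintype.card α * p := by rw [Finset.sum_const, Finset.card_univ, nsmul_eq_mul]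
  · exact not_le.1 fun hi => hω (Set.mem_iUnion.2 ⟨i, hi⟩)

lemma exists_event_forall_mem_convexHull_le {α V H : Type*} [Fintype α] [DecidableEq α]
    [AddCommGroup V] [Module ℝ V] [NormedAddCommGroup H] [InnerProductSpace ℝ H] {D : Ω → V →ₗ[ℝ] ℝ}
    (hD : ∀ w, Measurable fun ω => D ω w) {A : V →ₗ[ℝ] H} {q ρ p : ℝ} (hq : 0 ≤ q)
    (hp : ∀ w, μ.real {ω | q * ‖A w‖ ^ 2 + ρ ≤ D ω w} ≤ p) {e : α → V} {B : ℝ}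
    (hB : ∀ i, ‖A (e i)‖ ^ 2 ≤ B) {k : ℕ} (hk : k ≠ 0) :
    ∃ E, MeasurableSet E ∧ 1 - Fintype.card (Sym α k) * p ≤ μ.real E ∧
      ∀ ω ∈ E, ∀ u ∈ convexHull ℝ (Set.range e), D ω u ≤ q * (‖A u‖ ^ 2 + B / k) + ρ := by
  obtain ⟨E, hE, hμE, hlt⟩ := exists_event_forall_lt
    (fun σ : Sym α k => hD (symAverage e σ)) fun σ => hp (symAverage e σ)
  refine ⟨E, hE, hμE, fun ω hω u hu => ?_⟩
  obtain ⟨σ, hσ⟩ := exists_symAverage_penalized_le hu (D ω) A hB hq hk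
  linarith [hlt ω hω σ]

end UniformBound

section BasicInequality

variable {m n : ℕ} {S : Matrix (Fin n) (Fin n) ℝ} {x : EuclideanSpace ℝ (Fin n)} {θ : ℝ → ℝ}
  {a : Fin m → EuclideanSpace ℝ (Fin n)} {y : Fin m → ℝ} {s : ℝ} {xhat : EuclideanSpace ℝ (Fin n)}

/-- The deviation of the objective `∑ i, y i * ⟨a i, w⟩` from its mean
`m * 𝔼[θ(g) g] * ⟨S^{1/2} x, S^{1/2} w⟩`, as a linear functional of `w`. -/
noncomputable def deviation (S : Matrix (Fin n) (Fin n) ℝ) (x : EuclideanSpace ℝ (Fin n))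
    (θ : ℝ → ℝ) (a : Fin m → EuclideanSpace ℝ (Fin n)) (y : Fin m → ℝ) :
    EuclideanSpace ℝ (Fin n) →ₗ[ℝ] ℝ :=
  ∑ i, (y i • innerₛₗ ℝ (a i)
    - correlation θ • (innerₛₗ ℝ (sqrtMap S x)).comp (sqrtMap S).toLinearMap)

lemma deviation_apply (S : Matrix (Fin n) (Fin n) ℝ) (x : EuclideanSpace ℝ (Fin n))
    (θ : ℝ → ℝ) (a : Fin m → EuclideanSpace ℝ (Fin n)) (y : Fin m → ℝ)
    (w : EuclideanSpace ℝ (Fin n)) :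
    deviation S x θ a y w = ∑ i, (y i * inner ℝ (a i) w
      - correlation θ * inner ℝ (sqrtMap S x) (sqrtMap S w)) := by
  simp [deviation]

lemma mul_norm_sqrtMap_sub_sq_le_deviation_sub (hθ : 0 ≤ correlation θ)
    (hx : ‖sqrtMap S x‖ = 1) (hxK : x ∈ feasibleSet S s) (hsol : IsSolution S s a y xhat) :
    m * correlation θ / 2 * ‖sqrtMap S xhat - sqrtMap S x‖ ^ 2
      ≤ deviation S x θ a y (xhat - x) := by
  have hopt : ∑ i, y i * inner ℝ (a i) x ≤ ∑ i, y i * inner ℝ (a i) xhat := hsol.2 hxK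
  have hdev : deviation S x θ a y (xhat - x)
      = ∑ i, y i * inner ℝ (a i) xhat - ∑ i, y i * inner ℝ (a i) x
        + m * correlation θ * (1 - inner ℝ (sqrtMap S x) (sqrtMap S xhat)) := by
    simp only [map_sub, deviation_apply, Finset.sum_sub_distrib, Finset.sum_const,
      Finset.card_univ, Fintype.card_fin, nsmul_eq_mul, real_inner_self_eq_norm_sq, hx]
    ring
  have hdist : ‖sqrtMap S xhat - sqrtMap S x‖ ^ 2
      ≤ 2 * (1 - inner ℝ (sqrtMap S x) (sqrtMap S xhat)) := by
    rw [norm_sub_sq_real, hx, real_inner_comm]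
    linarith [pow_le_one₀ (n := 2) (norm_nonneg _) hsol.1.2]
  calc m * correlation θ / 2 * ‖sqrtMap S xhat - sqrtMap S x‖ ^ 2
      ≤ m * correlation θ / 2 * (2 * (1 - inner ℝ (sqrtMap S x) (sqrtMap S xhat))) := by gcongr
    _ ≤ deviation S x θ a y (xhat - x) := by linarith

lemma norm_sqrtMap_sub_sq_le_of_deviation_le (hm : 0 < m) {δ : ℝ}
    (hθ : 0 < correlation θ) (hx : ‖sqrtMap S x‖ = 1) (hxK : x ∈ feasibleSet S s)
    (hdev : ∀ u ∈ feasibleSet S s, deviation S x θ a y u ≤ δ * m / 4)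
    (hsol : IsSolution S s a y xhat) :
    ‖sqrtMap S xhat - sqrtMap S x‖ ^ 2 ≤ δ / correlation θ := by
  have hm0 : (0 : ℝ) < m := Nat.cast_pos.2 hm
  have hbasic := mul_norm_sqrtMap_sub_sq_le_deviation_sub hθ.le hx hxK hsol
  have hsymm := hdev _ (neg_mem_feasibleSet hxK)
  rw [sub_eq_add_neg xhat, map_add (deviation S x θ a y)] at hbasic
  rw [le_div_iff₀ hθ]
  refine le_of_mul_le_mul_left ?_ (half_pos hm0)
  linarith [hdev _ hsol.1]

end BasicInequality

section Model

variable {Ω : Type*} [MeasurableSpace Ω] {μ : Measure Ω} {m n : ℕ}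
  {S : Matrix (Fin n) (Fin n) ℝ} {x : EuclideanSpace ℝ (Fin n)} {θ : ℝ → ℝ}
  {a : Fin m → Ω → EuclideanSpace ℝ (Fin n)} {y : Fin m → Ω → ℝ}

lemma IsModel.abs_y (h : IsModel μ S x θ a y) (i : Fin m) (ω : Ω) : |y i ω| = 1 := by
  rcases h.y_mem i ω with hy | hy <;> simp [hy]

lemma IsModel.comap_le (h : IsModel μ S x θ a y) :
    MeasurableSpace.comap (fun ω i => a i ω) inferInstance ≤ ‹MeasurableSpace Ω› :=
  (measurable_pi_lambda _ h.measurable_a).comap_le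

lemma IsModel.abs_theta_inner_le (h : IsModel μ S x θ a y) (i : Fin m) :
    ∀ᵐ ω ∂μ, |θ (inner ℝ (a i ω) x)| ≤ 1 := by
  filter_upwards [h.condMean_y i, ae_bdd_abs_condExp_of_ae_bdd_abs (R := 1)
    (m := MeasurableSpace.comap (fun ω i => a i ω) inferInstance)
    (ae_of_all μ fun ω => (h.abs_y i ω).le)] with ω hmean hbound
  rwa [← hmean]

lemma IsModel.measurable_deviation (h : IsModel μ S x θ a y) (w : EuclideanSpace ℝ (Fin n)) :
    Measurable fun ω => deviation S x θ (fun i => a i ω) (fun i => y i ω) w := by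
  simp_rw [deviation_apply]
  exact Finset.measurable_fun_sum _ fun i _ =>
    ((h.measurable_y i).mul (h.measurable_a i).inner_const).sub_const _

variable [IsProbabilityMeasure μ]

lemma IsModel.integrable_y (h : IsModel μ S x θ a y) (i : Fin m) : Integrable (y i) μ :=
  .of_bound (h.measurable_y i).aestronglyMeasurable 1 (ae_of_all _ fun ω => (h.abs_y i ω).le)

lemma IsModel.iIndepFun_prodMk (h : IsModel μ S x θ a y) :
    iIndepFun (fun i ω => (a i ω, y i ω)) μ := by
  refine iIndepFun_prodMk_of_condExp (q := fun _ B v => signProb B (θ (inner ℝ v x)))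
    h.measurable_a h.indep_a h.measurable_y (fun _ B _ => (measurable_signProb B).comp
      (h.measurable_theta.comp (by fun_prop))) fun T B hB => ?_
  filter_upwards [h.condIndep_y T B hB, ae_all_iff.2 fun i => condExp_preimage_of_sign h.comap_le
    (h.integrable_y i) (h.y_mem i) (h.condMean_y i) (B i)] with ω hprod hsign
  rw [hprod, Finset.prod_apply]
  exact Finset.prod_congr rfl fun i _ => hsign i

lemma IsModel.integral_y_mul_inner (h : IsModel μ S x θ a y) (hS : S.PosSemidef)
    (hx : ‖sqrtMap S x‖ = 1) (i : Fin m) (w : EuclideanSpace ℝ (Fin n)) :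
    ∫ ω, y i ω * inner ℝ (a i ω) w ∂μ
      = correlation θ * inner ℝ (sqrtMap S x) (sqrtMap S w) := by
  have hgauss (v : EuclideanSpace ℝ (Fin n)) : Integrable (fun ω => inner ℝ (a i ω) v) μ :=
    (hasGaussianLaw_inner (h.law_a i).hasGaussianLaw v).integrable
  have hinner : StronglyMeasurable[MeasurableSpace.comap (fun ω i => a i ω) inferInstance]
      (fun ω => inner ℝ (a i ω) w) :=
    ((show Measurable fun f : Fin m → EuclideanSpace ℝ (Fin n) => inner ℝ (f i) w by fun_prop).comp
      (comap_measurable (fun ω i => a i ω))).stronglyMeasurable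
  have hθ : AEStronglyMeasurable (fun ω => θ (inner ℝ (a i ω) x)) μ :=
    (h.measurable_theta.comp ((h.measurable_a i).inner_const)).aestronglyMeasurable
  calc ∫ ω, y i ω * inner ℝ (a i ω) w ∂μ
      = ∫ ω, (μ[y i | MeasurableSpace.comap (fun ω i => a i ω) inferInstance]) ω
          * inner ℝ (a i ω) w ∂μ :=
        integral_mul_eq_integral_condExp_mul h.comap_le (h.integrable_y i) hinner
          ((hgauss w).bdd_mul (c := 1) (h.measurable_y i).aestronglyMeasurable
            (ae_of_all _ fun ω => (h.abs_y i ω).le))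
    _ = ∫ ω, θ (inner ℝ (a i ω) x) * inner ℝ (a i ω) w ∂μ :=
        integral_congr_ae ((h.condMean_y i).mono fun ω hω => congrArg (· * inner ℝ (a i ω) w) hω)
    _ = correlation θ * inner ℝ (sqrtMap S x) (sqrtMap S w) :=
        integral_comp_inner_mul_inner (h.law_a i) hS hx h.measurable_theta
          (fun v => (hgauss v).bdd_mul (c := 1) hθ (h.abs_theta_inner_le i)) w

lemma IsModel.hasSubgaussianMGF_y_mul_inner_sub (h : IsModel μ S x θ a y) (hS : S.PosSemidef)
    (hx : ‖sqrtMap S x‖ = 1) (i : Fin m) (w : EuclideanSpace ℝ (Fin n)) :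
    HasSubgaussianMGF (fun ω => y i ω * inner ℝ (a i ω) w
      - correlation θ * inner ℝ (sqrtMap S x) (sqrtMap S w)) (2 * ‖sqrtMap S w‖₊ ^ 2) μ := by
  rw [← h.integral_y_mul_inner hS hx i w]
  exact hasSubgaussianMGF_mul_sub_integral (hasSubgaussianMGF_inner (h.law_a i) hS w)
    (h.measurable_y i).aestronglyMeasurable (ae_of_all _ fun ω => (h.abs_y i ω).le)

lemma IsModel.hasSubgaussianMGF_deviation (h : IsModel μ S x θ a y) (hS : S.PosSemidef)
    (hx : ‖sqrtMap S x‖ = 1) (w : EuclideanSpace ℝ (Fin n)) :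
    HasSubgaussianMGF (fun ω => deviation S x θ (fun i => a i ω) (fun i => y i ω) w)
      (m * (2 * ‖sqrtMap S w‖₊ ^ 2)) μ := by
  have hindep : iIndepFun (fun i ω => y i ω * inner ℝ (a i ω) w
      - correlation θ * inner ℝ (sqrtMap S x) (sqrtMap S w)) μ :=
    h.iIndepFun_prodMk.comp (fun _ p => p.2 * inner ℝ p.1 w
      - correlation θ * inner ℝ (sqrtMap S x) (sqrtMap S w)) (fun _ => by fun_prop)
  have hsum := HasSubgaussianMGF.sum_of_iIndepFun hindep (s := Finset.univ)
    fun i _ => h.hasSubgaussianMGF_y_mul_inner_sub hS hx i w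
  simpa only [deviation_apply, Finset.sum_const, Finset.card_univ, Fintype.card_fin,
    nsmul_eq_mul] using hsum

lemma IsModel.measureReal_deviation_ge_le (h : IsModel μ S x θ a y) (hS : S.PosSemidef)
    (hx : ‖sqrtMap S x‖ = 1) {t : ℝ} (ht : 0 < t) (ρ : ℝ) (w : EuclideanSpace ℝ (Fin n)) :
    μ.real {ω | t * m * ‖sqrtMap S w‖ ^ 2 + ρ / t
      ≤ deviation S x θ (fun i => a i ω) (fun i => y i ω) w} ≤ Real.exp (-ρ) := by
  convert measureReal_tilt_ge_le (h.hasSubgaussianMGF_deviation hS hx w) ht ρ using 5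
  push_cast
  ring

lemma IsModel.exists_event_deviation_le_two_mul_add [NeZero n] (h : IsModel μ S x θ a y)
    (hS : S.PosDef) (hx : ‖sqrtMap S x‖ = 1) {s : ℝ} (hs : 0 < s) {k : ℕ}
    (hk : condNumber S * s ≤ k) {t : ℝ} (ht : 0 < t) (ρ : ℝ) :
    ∃ E : Set Ω, MeasurableSet E ∧
      1 - (2 * n + k).choose k * Real.exp (-ρ) ≤ μ.real E ∧
      ∀ ω ∈ E, ∀ u ∈ feasibleSet S s,
        deviation S x θ (fun i => a i ω) (fun i => y i ω) u ≤ 2 * t * m + ρ / t := by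
  have hr : 0 < s / lambdaMin S := div_pos hs (lambdaMin_pos hS)
  have hκs : 0 < condNumber S * s := mul_pos (one_pos.trans_le (one_le_condNumber hS)) hs
  have hk0 : (0 : ℝ) < k := hκs.trans_le hk
  obtain ⟨E, hE, hμE, hdev⟩ := exists_event_forall_mem_convexHull_le (μ := μ)
    h.measurable_deviation (A := (sqrtMap S).toLinearMap) (q := t * m) (by positivity)
    (h.measureReal_deviation_ge_le hS.posSemidef hx ht ρ)
    (norm_sqrtMap_crossVertex_sq_le hS hs.le) (Nat.cast_pos.1 hk0).ne'
  rw [card_sym_option_prod_bool] at hμE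
  refine ⟨E, hE, hμE, fun ω hω u hu => ?_⟩
  calc deviation S x θ (fun i => a i ω) (fun i => y i ω) u
      ≤ t * m * (‖sqrtMap S u‖ ^ 2 + condNumber S * s / k) + ρ / t :=
        hdev ω hω u (mem_convexHull_range_crossVertex (Real.sqrt_pos.2 hr) hu.1)
    _ ≤ t * m * (1 + 1) + ρ / t := by
        gcongr
        · exact pow_le_one₀ (norm_nonneg _) hu.2
        · exact (div_le_one hk0).2 hk
    _ = 2 * t * m + ρ / t := by ring

lemma IsModel.exists_event_deviation_le [NeZero n] (h : IsModel μ S x θ a y) (hS : S.PosDef)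
    (hx : ‖sqrtMap S x‖ = 1) {s : ℝ} (hκs : 1 ≤ condNumber S * s) (hsn : s ≤ n) {δ : ℝ}
    (hδ : 0 < δ)
    (hm : 2048 * condNumber S * (δ ^ 2)⁻¹ * s * Real.log (2 * n / s) ≤ m) :
    ∃ E : Set Ω, MeasurableSet E ∧ 1 - Real.exp (-(1 / 256) * δ ^ 2 * m) ≤ μ.real E ∧
      ∀ ω ∈ E, ∀ u ∈ feasibleSet S s,
        deviation S x θ (fun i => a i ω) (fun i => y i ω) u ≤ δ * m / 4 := by
  have hκ := one_le_condNumber hS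
  have hs := pos_of_one_le_condNumber_mul hS hκs
  have hratio := two_le_two_mul_div hs hsn
  set k := ⌈condNumber S * s⌉₊
  have hk : condNumber S * s ≤ k := Nat.le_ceil _
  have hk_le : (k : ℝ) ≤ 2 * (condNumber S * s) := by
    linarith [Nat.ceil_lt_add_one (zero_le_one.trans hκs)]
  have hsk : s ≤ k := (le_mul_of_one_le_left hs.le hκ).trans hk
  have hlog : 4 * k * Real.log (2 * n / s) ≤ 1 / 256 * δ ^ 2 * m := by
    calc 4 * k * Real.log (2 * n / s)
        ≤ 4 * (2 * (condNumber S * s)) * Real.log (2 * n / s) := by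
          gcongr
          exact Real.log_nonneg (one_le_two.trans hratio)
      _ = 1 / 256 * δ ^ 2 * (2048 * condNumber S * (δ ^ 2)⁻¹ * s * Real.log (2 * n / s)) := by
          field_simp
          ring
      _ ≤ 1 / 256 * δ ^ 2 * m := by gcongr
  have hcount : ((2 * n : ℕ) : ℝ) ≤ 2 * n / s * k := by
    rw [div_mul_eq_mul_div, le_div_iff₀ hs]
    push_cast
    gcongr
  obtain ⟨E, hE, hμE, hdev⟩ := h.exists_event_deviation_le_two_mul_add hS hx hs hk
    (t := δ / 16) (by positivity) (2 * (1 / 256 * δ ^ 2 * m))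
  refine ⟨E, hE, ?_, fun ω hω u hu => (hdev ω hω u hu).trans_eq ?_⟩
  · rw [neg_mul, neg_mul]
    linarith [choose_add_mul_exp_le hratio hcount hlog]
  · field_simp
    ring

end Model

end OneBit

theorem mainTheorem6_general {Ω : Type*} [MeasurableSpace Ω] {μ : Measure Ω}
    [IsProbabilityMeasure μ] {m n : ℕ} {S : Matrix (Fin n) (Fin n) ℝ} (hS : S.PosDef) {s : ℝ}
    (hsn : s ≤ n) {x : EuclideanSpace ℝ (Fin n)}
    (hx1 : OneBit.l1Norm x ≤ √(s / OneBit.lambdaMin S)) (hx : ‖OneBit.sqrtMap S x‖ = 1)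
    {θ : ℝ → ℝ} {a : Fin m → Ω → EuclideanSpace ℝ (Fin n)} {y : Fin m → Ω → ℝ}
    (h : OneBit.IsModel μ S x θ a y) {δ : ℝ} (hδ : 0 < δ)
    (hm : 2048 * OneBit.condNumber S * (δ ^ 2)⁻¹ * s * Real.log (2 * n / s) ≤ m) :
    ∃ E : Set Ω, MeasurableSet E ∧ 1 - Real.exp (-(1 / 256) * δ ^ 2 * m) ≤ μ.real E ∧
      ∀ ω ∈ E,
        (∃ xhat, OneBit.IsSolution S s (fun i => a i ω) (fun i => y i ω) xhat) ∧
        ∀ xhat, OneBit.IsSolution S s (fun i => a i ω) (fun i => y i ω) xhat →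
          OneBit.lambdaMin S * ‖xhat - x‖ ^ 2
              ≤ ‖OneBit.sqrtMap S xhat - OneBit.sqrtMap S x‖ ^ 2 ∧
          ‖OneBit.sqrtMap S xhat - OneBit.sqrtMap S x‖ ^ 2 ≤ δ / OneBit.correlation θ := by
  have : NeZero n := ⟨by rintro rfl; simp [Subsingleton.elim x 0] at hx⟩
  have hxK : x ∈ OneBit.feasibleSet S s := ⟨hx1, hx.le⟩
  have hκs := OneBit.one_le_condNumber_mul hS hx hxK
  obtain ⟨E, hE, hμE, hdev⟩ := h.exists_event_deviation_le hS hx hκs hsn hδ hm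
  have hm0 : 0 < m := Nat.cast_pos.1 <|
    (OneBit.sampleSize_pos hS hκs hsn (by norm_num) hδ).trans_le hm
  refine ⟨E, hE, hμE, fun ω hω => ⟨OneBit.exists_isSolution ⟨x, hxK⟩ _ _, fun xhat hsol => ⟨?_,
    OneBit.norm_sqrtMap_sub_sq_le_of_deviation_le hm0 h.correlation_pos hx hxK (hdev ω hω) hsol⟩⟩⟩
  rw [← map_sub]
  exact OneBit.lambdaMin_mul_norm_sq_le hS.posSemidef _

theorem mainTheorem6 :
    ∃ C c : ℝ, 0 < C ∧ 0 < c ∧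
      ∀ {Ω : Type*} [MeasurableSpace Ω] (μ : Measure Ω) [IsProbabilityMeasure μ]
        (m n : ℕ) (S : Matrix (Fin n) (Fin n) ℝ) (_ : S.PosDef)
        (s : ℝ) (_ : 0 < s) (_ : s ≤ n)
        (x : EuclideanSpace ℝ (Fin n)) (_ : (OneBit.l0Norm x : ℝ) ≤ s)
        (_ : ‖OneBit.sqrtMap S x‖ = 1)
        (θ : ℝ → ℝ) (a : Fin m → Ω → EuclideanSpace ℝ (Fin n)) (y : Fin m → Ω → ℝ)
        (_ : OneBit.IsModel μ S x θ a y)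
        (δ : ℝ) (_ : 0 < δ)
        (_ : C * OneBit.condNumber S * (δ ^ 2)⁻¹ * s * Real.log (2 * n / s) ≤ m),
        ∃ E : Set Ω, MeasurableSet E ∧
          1 - 8 * Real.exp (-c * δ ^ 2 * m) ≤ μ.real E ∧
          ∀ ω ∈ E,
            (∃ xhat, OneBit.IsSolution S s (fun i => a i ω) (fun i => y i ω) xhat) ∧
            ∀ xhat, OneBit.IsSolution S s (fun i => a i ω) (fun i => y i ω) xhat →
              OneBit.lambdaMin S * ‖xhat - x‖ ^ 2
                  ≤ ‖OneBit.sqrtMap S xhat - OneBit.sqrtMap S x‖ ^ 2 ∧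
              ‖OneBit.sqrtMap S xhat - OneBit.sqrtMap S x‖ ^ 2
                  ≤ δ / OneBit.correlation θ := by
  refine ⟨2048, 1 / 256, by norm_num, by norm_num, ?_⟩
  intro Ω _ μ _ m n S hS s hs hsn x hxs hx θ a y h δ hδ hm
  have : NeZero n := ⟨(Nat.cast_pos.1 (hs.trans_le hsn)).ne'⟩
  have hx1 := (OneBit.mem_feasibleSet_of_l0Norm_le hS hxs hx.le).1
  obtain ⟨E, hE, hμE, hrec⟩ := mainTheorem6_general hS hsn hx1 hx h hδ hm
  exact ⟨E, hE, by linarith [Real.exp_pos (-(1 / 256) * δ ^ 2 * m)], hrec⟩
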